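/- Let $q$ be a prime power, let $n,k,M$ be positive integers with $k\le n$, and let $V$ be an $n$-dimensional vector space over the field $\mathbb F_q$ with $q$ elements. Write $\binom{a}{b}_q=\prod_{i=0}^{b-1}\frac{q^{a-i}-1}{q^{b-i}-1}$ for the Gaussian binomial coefficient. For a family $\mathcal F$ of $k$-dimensional subspaces of $V$ put $$\mathcal I(\mathcal F)=\sum_{A\in\mathcal F}\sum_{B\in\mathcal F}\dim(A\cap B),\qquad \mathcal{MI}(\mathcal F)=\max_{|\mathcal G|=|\mathcal F|}\mathcal I(\mathcal G),$$ where the maximum is over all families $\mathcal G$ of $k$-dimensional subspaces of $V$ with $|\mathcal G|=|\mathcal F|$. If $|\mathcal F|=M$, then $$\mathcal{MI}(\mathcal F)\le\left(\frac{\binom{n}{k}_q}{M}-\binom{n}{1}_q\right)\frac{q\,M^2\binom{k}{1}_q\binom{n-k}{1}_q}{\binom{n}{1}_q\left(\binom{n}{1}_q-1\right)}+kM^2 .$$ If moreover $n\ge 2k$ and $M\le\binom{n-1}{k-1}_q$, then $$\mathcal{MI}(\mathcal F)\le\left[\frac{\binom{n}{k}_q}{M}-\frac{(q^n-1)(q^{n-1}-1)}{(q-1)(q^k-1)}\right]\frac{M^2(q^k-1)(q^{k-1}-1)(q^{n-k}-1)}{(q^n-1)(q^{n-1}-1)(q^{n-2}-1)}+kM^2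 .$$ In the two degenerate cases where the second fraction of a bound has the form $0/0$ (the first bound for $n=k=1$, the second for $n=2$, $k=1$), that fraction is read as $0$. -/

import Mathlib

/-- The Gaussian binomial coefficient `[n choose k]_q`, that is
`∏_{i < k} (q^(n-i) - 1) / (q^(k-i) - 1)`, as a real number. It is used for `q ≥ 2`, so no
denominator vanishes; for `k > n` the factor `i = n` makes it `0`. -/
noncomputable def gaussBinom (q n k : ℕ) : ℝ :=
  ∏ i ∈ Finset.range k, ((q : ℝ) ^ (n - i) - 1) / ((q : ℝ) ^ (k - i) - 1)

/-- The set of all `k`-dimensional subspaces of `V`. -/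
abbrev Grass (K V : Type*) [Field K] [AddCommGroup V] [Module K V] (k : ℕ) : Type _ :=
  {U : Submodule K V // Module.finrank K U = k}

/-- The total intersection number: the sum of `dim (A ∩ B)` over all ordered pairs `(A, B)` of
members of the family, including the pairs with `A = B`. -/
noncomputable def totalInt {K V : Type*} [Field K] [AddCommGroup V] [Module K V] {k : ℕ}
    (F : Finset (Grass K V k)) : ℕ :=
  ∑ A ∈ F, ∑ B ∈ F, Module.finrank K (A.1 ⊓ B.1 : Submodule K V)

/-- The maximal total intersection number among all families of `k`-dimensional subspaces
with the same size as the given one. -/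
noncomputable def maxTotalInt {K V : Type*} [Field K] [AddCommGroup V] [Module K V] {k : ℕ}
    (F : Finset (Grass K V k)) : ℕ :=
  sSup {m : ℕ | ∃ G : Finset (Grass K V k), G.card = F.card ∧ totalInt G = m}

/-- Over a finite field and in finite dimension the supremum above is an attained maximum. -/
theorem isGreatest_maxTotalInt {K V : Type*} [Field K] [Finite K] [AddCommGroup V] [Module K V]
    [FiniteDimensional K V] {k : ℕ} (F : Finset (Grass K V k)) :
    IsGreatest {m : ℕ | ∃ G : Finset (Grass K V k), G.card = F.card ∧ totalInt G = m}
      (maxTotalInt F) := by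
  have hV : Finite V := Module.finite_of_finite K
  have hS : Finite (Submodule K V) :=
    Finite.of_injective (fun U : Submodule K V => (U : Set V)) SetLike.coe_injective
  have hfin : {m : ℕ | ∃ G : Finset (Grass K V k), G.card = F.card ∧ totalInt G = m}.Finite := by
    refine (Set.finite_range (totalInt (K := K) (V := V) (k := k))).subset ?_
    rintro m ⟨G, -, rfl⟩
    exact ⟨G, rfl⟩
  exact ⟨Nat.sSup_mem ⟨_, F, rfl, rfl⟩ hfin.bddAbove, fun m hm => le_csSup hfin.bddAbove hm⟩

/-!
Incidence between points and `k`-dimensional subspaces is a 2-design, so a variance argument bounds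
the number of triples `(P, A, B)` with `A, B ∈ F` and `P` a point of `A ⊓ B`, that is, the sum of
the `q`-integers `[dim (A ⊓ B)]`. Since `[k] - [d] ≤ q ^ (k - 1) * (k - d)`, this bounds the sum of
the dimensions and gives the first bound.

For the second bound, write `t = k - dim (A ⊓ B)`. When `2 * k ≤ n` there is a kernel `w t` with
`w 0 = 1` whose sum over the `A` containing any given `(k - 1)`-dimensional subspace vanishes. Its
columns lie in the eigenspace of the Grassmann graph with the least eigenvalue, so the matrix `w t`
is a positive multiple of a projection and `∑ A ∈ F, ∑ B ∈ F, w t ≥ 0`. For `t ≥ 1`, a suitable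
affine function of `w t` with nonnegative slope is at most `t`. Summing over `F` bounds `∑ t` from
below up to a correction from the diagonal pairs `A = B`, which is controlled by
`1 + q * [k - 2] * [n - k] ≤ gaussBinom q (n - 2) (k - 2)`.
-/

open Module Finset

/-- The `q`-integer `1 + q + ⋯ + q ^ (n - 1)`, the number of points of an `n`-dimensional space
over a field with `q` elements. It equals `gaussBinom q n 1`, but as a sum it splits over `n`
without divisions. -/
def qInt (q : ℝ) (n : ℕ) : ℝ := ∑ i ∈ range n, q ^ i

section QInt

variable {q : ℝ}

@[simp] theorem qInt_zero (q : ℝ) : qInt q 0 = 0 := by simp [qInt]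

@[simp] theorem qInt_one (q : ℝ) : qInt q 1 = 1 := by simp [qInt]

theorem qInt_succ (q : ℝ) (n : ℕ) : qInt q (n + 1) = q * qInt q n + 1 := geom_sum_succ

theorem qInt_add (q : ℝ) (m n : ℕ) : qInt q (m + n) = qInt q m + q ^ m * qInt q n := by
  simp only [qInt, sum_range_add, pow_add, mul_sum]

theorem qInt_mul_sub_one (q : ℝ) (n : ℕ) : qInt q n * (q - 1) = q ^ n - 1 := geom_sum_mul q n

theorem qInt_nonneg (hq : 0 ≤ q) (n : ℕ) : 0 ≤ qInt q n := sum_nonneg fun _ _ => by positivity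

theorem one_le_qInt (hq : 0 ≤ q) {n : ℕ} (hn : n ≠ 0) : 1 ≤ qInt q n := by
  obtain ⟨n, rfl⟩ := Nat.exists_eq_succ_of_ne_zero hn
  rw [qInt_succ]
  linarith [mul_nonneg hq (qInt_nonneg hq n)]

theorem qInt_pos (hq : 0 ≤ q) {n : ℕ} (hn : n ≠ 0) : 0 < qInt q n :=
  one_pos.trans_le (one_le_qInt hq hn)

theorem qInt_le_pow_sub_one (hq : 2 ≤ q) (n : ℕ) : qInt q n ≤ q ^ n - 1 := by
  rw [← qInt_mul_sub_one]
  exact le_mul_of_one_le_right (qInt_nonneg (by linarith) n) (by linarith)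

theorem qInt_sub_le (hq : 1 ≤ q) {d k : ℕ} (hd : d ≤ k + 1) :
    qInt q (k + 1) - qInt q d ≤ (k + 1 - d) * q ^ k := by
  calc qInt q (k + 1) - qInt q d = ∑ i ∈ Ico d (k + 1), q ^ i := (sum_Ico_eq_sub _ hd).symm
    _ ≤ ∑ _i ∈ Ico d (k + 1), q ^ k :=
        sum_le_sum fun i hi => pow_le_pow_right₀ hq (Nat.lt_succ_iff.1 (mem_Ico.1 hi).2)
    _ = (k + 1 - d) * q ^ k := by simp [Nat.cast_sub hd]

end QInt

section GaussBinom

variable {q : ℕ}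

@[simp] theorem gaussBinom_zero_right (q n : ℕ) : gaussBinom q n 0 = 1 := by simp [gaussBinom]

theorem gaussBinom_eq_zero {n k : ℕ} (q : ℕ) (h : n < k) : gaussBinom q n k = 0 :=
  prod_eq_zero (mem_range.2 h) (by simp)

theorem gaussBinom_one_right (hq : 1 < q) (n : ℕ) : gaussBinom q n 1 = qInt q n := by
  have hq' : (q : ℝ) - 1 ≠ 0 := (sub_pos.2 (by exact_mod_cast hq)).ne'
  simp [gaussBinom, ← qInt_mul_sub_one, hq']

theorem gaussBinom_succ_succ_mul (hq : 1 < q) (n k : ℕ) :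
    gaussBinom q (n + 1) (k + 1) * qInt q (k + 1) = qInt q (n + 1) * gaussBinom q n k := by
  have hq' : (q : ℝ) - 1 ≠ 0 := (sub_pos.2 (by exact_mod_cast hq)).ne'
  have hk : qInt q (k + 1) ≠ 0 := (qInt_pos q.cast_nonneg k.succ_ne_zero).ne'
  rw [gaussBinom, prod_range_succ', gaussBinom]
  simp only [Nat.add_sub_add_right, Nat.sub_zero, ← qInt_mul_sub_one]
  field_simp

theorem gaussBinom_succ_right_mul (hq : 1 < q) (n k : ℕ) :
    gaussBinom q n (k + 1) * qInt q (k + 1) = qInt q (n - k) * gaussBinom q n k := by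
  induction n generalizing k with
  | zero => cases k <;> simp [gaussBinom_eq_zero]
  | succ n ih =>
    cases k with
    | zero => simp [gaussBinom_one_right hq]
    | succ k =>
      have hk1 : qInt q (k + 1) ≠ 0 := (qInt_pos q.cast_nonneg k.succ_ne_zero).ne'
      have h1 := gaussBinom_succ_succ_mul hq n (k + 1)
      have h2 := gaussBinom_succ_succ_mul hq n k
      rw [h1, Nat.add_sub_add_right]
      refine mul_right_cancel₀ hk1 ?_
      linear_combination qInt (q : ℝ) (n + 1) * ih k - qInt (q : ℝ) (n - k) * h2

theorem gaussBinom_pascal (hq : 1 < q) (n k : ℕ) :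
    gaussBinom q (n + 1) (k + 1) =
      gaussBinom q n k + (q : ℝ) ^ (k + 1) * gaussBinom q n (k + 1) := by
  obtain hk | hk := lt_or_ge n k
  · simp [gaussBinom_eq_zero, hk, hk.trans k.lt_succ_self]
  have hk1 : qInt q (k + 1) ≠ 0 := (qInt_pos q.cast_nonneg k.succ_ne_zero).ne'
  have hsplit := qInt_add q (k + 1) (n - k)
  rw [show k + 1 + (n - k) = n + 1 by omega] at hsplit
  refine mul_right_cancel₀ hk1 ?_
  linear_combination gaussBinom_succ_succ_mul hq n k + gaussBinom q n k * hsplit -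
    (q : ℝ) ^ (k + 1) * gaussBinom_succ_right_mul hq n k

theorem gaussBinom_nonneg (hq : 1 < q) (n k : ℕ) : 0 ≤ gaussBinom q n k :=
  prod_nonneg fun i _ => div_nonneg (sub_nonneg.2 (one_le_pow₀ (by exact_mod_cast hq.le)))
    (sub_nonneg.2 (one_le_pow₀ (by exact_mod_cast hq.le)))

theorem gaussBinom_pos (hq : 1 < q) {n k : ℕ} (hk : k ≤ n) : 0 < gaussBinom q n k := by
  have hq' : (1 : ℝ) < q := by exact_mod_cast hq
  refine prod_pos fun i hi => div_pos ?_ ?_ <;>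
  · have := mem_range.1 hi
    exact sub_pos.2 (one_lt_pow₀ hq' (by omega))

theorem gaussBinom_succ_self (hq : 1 < q) (k : ℕ) : gaussBinom q (k + 1) k = qInt q (k + 1) := by
  induction k with
  | zero => simp
  | succ k ih =>
    have hk1 : qInt q (k + 1) ≠ 0 := (qInt_pos q.cast_nonneg k.succ_ne_zero).ne'
    refine mul_right_cancel₀ hk1 ?_
    rw [gaussBinom_succ_succ_mul hq, ih]

theorem qInt_le_gaussBinom_add (hq : 1 < q) (b m : ℕ) :
    qInt q m ≤ gaussBinom q (b + m) (b + 1) := by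
  induction b with
  | zero => simp [gaussBinom_one_right hq]
  | succ b ih =>
    rw [Nat.add_right_comm, gaussBinom_pascal hq]
    linarith [mul_nonneg (pow_nonneg (q.cast_nonneg (α := ℝ)) (b + 1 + 1))
      (gaussBinom_nonneg hq (b + m) (b + 1 + 1))]

/-- Both sides count `b`-dimensional subspaces of a `(b + m)`-dimensional space: on the left, those
meeting a fixed one in dimension at least `b - 1`. -/
theorem one_add_mul_qInt_le_gaussBinom (hq : 1 < q) (b m : ℕ) :
    1 + q * qInt q b * qInt q m ≤ gaussBinom q (b + m) b := by
  induction b with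
  | zero => simp
  | succ b ih =>
    have hpoints := mul_le_mul_of_nonneg_left (qInt_le_gaussBinom_add hq b m)
      (pow_nonneg (q.cast_nonneg (α := ℝ)) (b + 1))
    rw [Nat.add_right_comm, gaussBinom_pascal hq, qInt_add, qInt_one]
    linear_combination ih + hpoints

end GaussBinom

section Dimension

variable {K V : Type*} [Field K] [AddCommGroup V] [Module K V]

theorem comap_mkQ_map_mkQ {U A : Submodule K V} (h : U ≤ A) : (A.map U.mkQ).comap U.mkQ = A := by
  rw [Submodule.comap_map_mkQ, sup_eq_right.2 h]

theorem map_mkQ_comap_mkQ (U : Submodule K V) (B : Submodule K (V ⧸ U)) :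
    (B.comap U.mkQ).map U.mkQ = B :=
  Submodule.map_comap_eq_of_surjective U.mkQ_surjective B

variable [FiniteDimensional K V]

theorem finrank_map_mkQ_add {U A : Submodule K V} (h : U ≤ A) :
    finrank K (A.map U.mkQ) + finrank K U = finrank K A := by
  have hUA := (Submodule.quotientQuotientEquivQuotient U A h).finrank_eq
  have hU := U.finrank_quotient_add_finrank
  have hA := A.finrank_quotient_add_finrank
  have hmap := (A.map U.mkQ).finrank_quotient_add_finrank
  omega

/-- The correspondence theorem for Grassmannians: subspaces containing `U` are the subspaces of
`V ⧸ U`, with dimensions shifted by `dim U`. -/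
def grassAboveEquiv (U : Submodule K V) {k l : ℕ} (hl : k + finrank K U = l) :
    {A : Grass K V l // U ≤ A.1} ≃ Grass K (V ⧸ U) k where
  toFun A := ⟨A.1.1.map U.mkQ, by have := finrank_map_mkQ_add A.2; have := A.1.2; omega⟩
  invFun B := ⟨⟨B.1.comap U.mkQ, by
    rw [← finrank_map_mkQ_add (U.le_comap_mkQ B.1), map_mkQ_comap_mkQ, B.2, hl]⟩,
    U.le_comap_mkQ B.1⟩
  left_inv A := Subtype.ext (Subtype.ext (comap_mkQ_map_mkQ A.2))
  right_inv B := Subtype.ext (map_mkQ_comap_mkQ U B.1)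

/-- Subspaces contained in `W`, viewed as subspaces of the vector space `W`. -/
def grassBelowEquiv (W : Submodule K V) (k : ℕ) :
    {A : Grass K V k // A.1 ≤ W} ≃ Grass K W k where
  toFun A := ⟨A.1.1.comap W.subtype, by
    rw [(Submodule.comapSubtypeEquivOfLe A.2).finrank_eq, A.1.2]⟩
  invFun B := ⟨⟨B.1.map W.subtype, by rw [Submodule.finrank_map_subtype_eq, B.2]⟩,
    W.map_subtype_le B.1⟩
  left_inv A := Subtype.ext (Subtype.ext (by
    simp only [Submodule.map_comap_subtype, inf_eq_right.2 A.2]))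
  right_inv B := Subtype.ext (Submodule.comap_map_eq_of_injective W.injective_subtype B.1)

end Dimension

section Counting

open scoped Classical

universe u v

variable {K : Type u} {V : Type v} [Field K] [Finite K] [AddCommGroup V] [Module K V]

variable (K V) in
theorem card_grass_one : (Nat.card (Grass K V 1) : ℝ) = qInt (Nat.card K) (finrank K V) := by
  rw [← Nat.card_congr (Projectivization.equivSubmodule K V),
    Projectivization.card_of_finrank K V rfl]
  simp [qInt]

variable [FiniteDimensional K V]

noncomputable instance Grass.instFintype (k : ℕ) : Fintype (Grass K V k) :=
  have : Finite V := Module.finite_of_finite K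
  Fintype.ofFinite _

theorem card_grass_ge_eq_natCard (U : Submodule K V) {k l : ℕ} (hl : k + finrank K U = l) :
    #{A : Grass K V l | U ≤ A.1} = Nat.card (Grass K (V ⧸ U) k) := by
  rw [← Nat.card_congr (grassAboveEquiv U hl), Nat.card_eq_fintype_card, Fintype.card_subtype]

theorem card_grass_le_eq_natCard (W : Submodule K V) (k : ℕ) :
    #{A : Grass K V k | A.1 ≤ W} = Nat.card (Grass K W k) := by
  rw [← Nat.card_congr (grassBelowEquiv W k), Nat.card_eq_fintype_card, Fintype.card_subtype]

variable (K V) in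
theorem card_grass (k : ℕ) :
    (Nat.card (Grass K V k) : ℝ) = gaussBinom (Nat.card K) (finrank K V) k := by
  induction k generalizing V with
  | zero =>
    have : Unique (Grass K V 0) :=
      ⟨⟨⟨⊥, finrank_bot K V⟩⟩, fun A => Subtype.ext (Submodule.finrank_eq_zero.1 A.2)⟩
    simp
  | succ k ih =>
    obtain hV | ⟨n, hn⟩ : finrank K V = 0 ∨ ∃ n, finrank K V = n + 1 := by
      cases finrank K V <;> simp
    · have : IsEmpty (Grass K V (k + 1)) := ⟨fun A => by
        have := A.1.finrank_le; have := A.2; omega⟩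
      rw [gaussBinom_eq_zero _ (by omega), Nat.card_of_isEmpty, Nat.cast_zero]
    have habove (P : Grass K V 1) :
        (#{A : Grass K V (k + 1) | P.1 ≤ A.1} : ℝ) = gaussBinom (Nat.card K) n k := by
      have hquot := P.1.finrank_quotient_add_finrank
      rw [P.2, hn, Nat.add_right_cancel_iff] at hquot
      rw [card_grass_ge_eq_natCard P.1 (by rw [P.2]), ih, hquot]
    have hbelow (A : Grass K V (k + 1)) :
        (#{P : Grass K V 1 | P.1 ≤ A.1} : ℝ) = qInt (Nat.card K) (k + 1) := by
      rw [card_grass_le_eq_natCard, card_grass_one, A.2]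
    have hcount := congrArg (Nat.cast (R := ℝ)) (sum_card_bipartiteAbove_eq_sum_card_bipartiteBelow
      (s := univ) (t := univ) fun (P : Grass K V 1) (A : Grass K V (k + 1)) => P.1 ≤ A.1)
    simp only [bipartiteAbove, bipartiteBelow, Nat.cast_sum, habove, hbelow, sum_const, card_univ,
      nsmul_eq_mul, ← Nat.card_eq_fintype_card, card_grass_one, hn] at hcount
    have hk1 : qInt (Nat.card K) (k + 1) ≠ 0 := (qInt_pos (Nat.cast_nonneg _) k.succ_ne_zero).ne'
    refine mul_right_cancel₀ hk1 ?_
    rw [← hcount, hn, gaussBinom_succ_succ_mul Finite.one_lt_card]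

theorem card_grass_ge (U : Submodule K V) {k l : ℕ} (hl : k + finrank K U = l) :
    (#{A : Grass K V l | U ≤ A.1} : ℝ) =
      gaussBinom (Nat.card K) (finrank K V - finrank K U) k := by
  rw [card_grass_ge_eq_natCard U hl, card_grass, ← U.finrank_quotient_add_finrank,
    Nat.add_sub_cancel_right]

theorem card_grass_le (W : Submodule K V) (k : ℕ) :
    (#{A : Grass K V k | A.1 ≤ W} : ℝ) = gaussBinom (Nat.card K) (finrank K W) k := by
  rw [card_grass_le_eq_natCard, card_grass]

theorem card_grass_ge_and_le {U W : Submodule K V} (hUW : U ≤ W) {k l : ℕ}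
    (hl : k + finrank K U = l) :
    (#{A : Grass K V l | U ≤ A.1 ∧ A.1 ≤ W} : ℝ) =
      gaussBinom (Nat.card K) (finrank K W - finrank K U) k := by
  have hU : finrank K (U.comap W.subtype) = finrank K U :=
    (Submodule.comapSubtypeEquivOfLe hUW).finrank_eq
  have hiff (A : {A : Grass K V l // A.1 ≤ W}) :
      U ≤ A.1.1 ↔ U.comap W.subtype ≤ (grassBelowEquiv W l A).1 := by
    rw [← Submodule.map_le_map_iff_of_injective W.injective_subtype]
    simp only [grassBelowEquiv, Equiv.coe_fn_mk, Submodule.map_comap_subtype, inf_eq_right.2 hUW,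
      inf_eq_right.2 A.2]
  have hcard := Nat.card_congr <|
    (Equiv.subtypeSubtypeEquivSubtypeInter (α := Grass K V l) (·.1 ≤ W) (U ≤ ·.1)).symm.trans
      ((grassBelowEquiv W l).subtypeEquiv (q := (U.comap W.subtype ≤ ·.1)) hiff)
  simp only [Nat.card_eq_fintype_card, Fintype.card_subtype, and_comm (b := U ≤ _)] at hcard
  rw [hcard, card_grass_ge _ (by rw [hU, hl]), hU]

end Counting

section TwoDesign

variable {π β : Type*} {I : π → β → Prop} [∀ P B, Decidable (I P B)] {κ r lam : ℝ}

theorem card_sub_sq_div_card_nonneg [Fintype β] (F : Finset β) :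
    0 ≤ (#F : ℝ) - (#F : ℝ) ^ 2 / Fintype.card β := by
  rw [sub_nonneg, sq]
  exact div_le_of_le_mul₀ (by positivity) (by positivity)
    (mul_le_mul_of_nonneg_left (by exact_mod_cast F.card_le_univ) (by positivity))

theorem sq_sum_le_mul_sum_sq_of_sum_eq_zero [Fintype β] (F : Finset β) {g : β → ℝ}
    (hg : ∑ B, g B = 0) :
    (∑ B ∈ F, g B) ^ 2 ≤ (#F - (#F : ℝ) ^ 2 / Fintype.card β) * ∑ B, g B ^ 2 := by
  classical
  obtain _ | _ := isEmpty_or_nonempty β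
  · simp [F.eq_empty_of_isEmpty]
  have hβ : (Fintype.card β : ℝ) ≠ 0 := by simp
  set c : ℝ := #F / Fintype.card β with hc
  set x : β → ℝ := fun B => (if B ∈ F then 1 else 0) - c with hx
  have hsum_mul : ∑ B, x B * g B = ∑ B ∈ F, g B := by
    simp [hx, sub_mul, sum_sub_distrib, ← mul_sum, hg]
  have hsum_sq : ∑ B, x B ^ 2 = #F - (#F : ℝ) ^ 2 / Fintype.card β := by
    simp only [hx, hc, sub_sq, ite_pow, one_pow, ne_eq, OfNat.ofNat_ne_zero, not_false_eq_true,
      zero_pow, mul_ite, mul_one, mul_zero, ite_mul, zero_mul, sum_add_distrib, sum_sub_distrib,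
      sum_ite_mem, univ_inter, sum_const, nsmul_eq_mul, card_univ]
    field_simp
    ring
  rw [← hsum_mul, ← hsum_sq]
  exact sum_mul_sq_le_sq_mul_sq univ x g

variable [Fintype π]

/-- The number of blocks of `F` on the point `P`, as a real number. -/
noncomputable def degreeIn (I : π → β → Prop) [∀ P B, Decidable (I P B)] (F : Finset β)
    (P : π) : ℝ :=
  #{B ∈ F | I P B}

theorem sum_degreeIn_mul (F : Finset β) (u : π → ℝ) :
    ∑ P, degreeIn I F P * u P = ∑ B ∈ F, ∑ P with I P B, u P := by
  simp only [degreeIn, sum_filter, card_filter, Nat.cast_sum, sum_mul]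
  rw [sum_comm]
  simp

theorem sum_sq_degreeIn (F : Finset β) :
    ∑ P, degreeIn I F P ^ 2 = ∑ A ∈ F, ∑ B ∈ F, (#{P | I P A ∧ I P B} : ℝ) := by
  simp only [sq, sum_degreeIn_mul]
  refine sum_congr rfl fun A _ => ?_
  simp only [degreeIn, card_filter, Nat.cast_sum]
  rw [sum_comm]
  simp [filter_filter]

variable [Fintype β]

/-- The incidence relation `I` between points and blocks is a balanced incomplete block design:
every block has `κ` points, every point lies on `r` blocks, and any two points lie on `lam` common
blocks. The parameters are real numbers since they are only used in real (in)equalities. -/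
structure IsTwoDesign (I : π → β → Prop) [∀ P B, Decidable (I P B)] (κ r lam : ℝ) : Prop where
  card_points : ∀ B, (#{P | I P B} : ℝ) = κ
  card_blocks : ∀ P, (#{B | I P B} : ℝ) = r
  card_common_blocks : ∀ ⦃P R⦄, P ≠ R → (#{B | I P B ∧ I R B} : ℝ) = lam

namespace IsTwoDesign

theorem sum_degreeIn (h : IsTwoDesign I κ r lam) (F : Finset β) :
    ∑ P, degreeIn I F P = κ * #F := by
  have := sum_degreeIn_mul (I := I) F 1
  simpa [h.card_points, mul_comm] using this

theorem sum_sum_points (h : IsTwoDesign I κ r lam) (f : π → ℝ) :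
    ∑ B, ∑ P with I P B, f P = r * ∑ P, f P := by
  simp only [sum_filter]
  rw [sum_comm, mul_sum]
  refine sum_congr rfl fun P _ => ?_
  rw [← sum_filter, sum_const, nsmul_eq_mul, h.card_blocks]

theorem sum_sq_sum_points (h : IsTwoDesign I κ r lam) (f : π → ℝ) :
    ∑ B, (∑ P with I P B, f P) ^ 2 = (r - lam) * ∑ P, f P ^ 2 + lam * (∑ P, f P) ^ 2 := by
  classical
  have hcommon (P R : π) : (#{B | I P B ∧ I R B} : ℝ) = (if P = R then r - lam else 0) + lam := by
    split_ifs with hPR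
    · simp [hPR, h.card_blocks]
    · simp [h.card_common_blocks hPR]
  calc ∑ B, (∑ P with I P B, f P) ^ 2
      = ∑ B, ∑ P, ∑ R, if I P B ∧ I R B then f P * f R else 0 := by
        refine sum_congr rfl fun B _ => ?_
        simp only [sum_filter, sq, sum_mul_sum, ite_and, mul_ite, ite_mul, zero_mul, mul_zero]
        refine sum_congr rfl fun P _ => sum_congr rfl fun R _ => ?_
        split_ifs <;> rfl
    _ = ∑ P, ∑ R, #{B | I P B ∧ I R B} * (f P * f R) := by
        rw [sum_comm]
        refine sum_congr rfl fun P _ => ?_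
        rw [sum_comm]
        simp only [← sum_filter, sum_const, nsmul_eq_mul]
    _ = (r - lam) * ∑ P, f P ^ 2 + lam * (∑ P, f P) ^ 2 := by
        simp only [hcommon, add_mul, sum_add_distrib, ite_mul, zero_mul, sum_ite_eq, mem_univ,
          if_true, ← mul_sum, sq]
        rw [← sum_mul]

/-- Let `f` be the deviation of the degrees in `F` from their mean, and `g B` the sum of `f` over
the points of a block `B`. Then `∑ f ^ 2 = ∑ B ∈ F, g B`, while `∑ g = 0` and
`∑ g ^ 2 = (r - lam) * ∑ f ^ 2`, so Cauchy–Schwarz bounds `∑ f ^ 2`. -/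
theorem sum_card_common_points_le [Nonempty π] (h : IsTwoDesign I κ r lam) (hlam : lam ≤ r)
    (F : Finset β) :
    ∑ A ∈ F, ∑ B ∈ F, (#{P | I P A ∧ I P B} : ℝ) ≤
      (κ * #F) ^ 2 / Fintype.card π + (r - lam) * (#F - (#F : ℝ) ^ 2 / Fintype.card β) := by
  have hπ : (Fintype.card π : ℝ) ≠ 0 := by simp
  set μ : ℝ := κ * #F / Fintype.card π with hμ
  set f : π → ℝ := fun P => degreeIn I F P - μ with hf
  set g : β → ℝ := fun B => ∑ P with I P B, f P with hg
  have hsum_f : ∑ P, f P = 0 := by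
    simp only [hf, hμ, sum_sub_distrib, h.sum_degreeIn, sum_const, card_univ, nsmul_eq_mul]
    field_simp
    ring
  have hsum_g : ∑ B, g B = 0 := by rw [hg, h.sum_sum_points, hsum_f, mul_zero]
  have hsum_g_sq : ∑ B, g B ^ 2 = (r - lam) * ∑ P, f P ^ 2 := by
    rw [hg, h.sum_sq_sum_points, hsum_f]; ring
  have hsum_F_g : ∑ B ∈ F, g B = ∑ P, f P ^ 2 := by
    calc ∑ B ∈ F, g B = ∑ P, (f P + μ) * f P := by
          simp only [hg, ← sum_degreeIn_mul, hf, sub_add_cancel]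
      _ = ∑ P, f P ^ 2 := by
          simp only [add_mul, sum_add_distrib, ← mul_sum, hsum_f, mul_zero, add_zero, sq]
  have hvariance : ∑ P, f P ^ 2 =
      ∑ A ∈ F, ∑ B ∈ F, (#{P | I P A ∧ I P B} : ℝ) - (κ * #F) ^ 2 / Fintype.card π := by
    simp only [hf, sub_sq, sum_add_distrib, sum_sub_distrib, sum_sq_degreeIn, ← sum_mul,
      ← mul_sum, h.sum_degreeIn, sum_const, card_univ, nsmul_eq_mul, hμ]
    field_simp
    ring
  have hspread := sq_sum_le_mul_sum_sq_of_sum_eq_zero F hsum_g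
  rw [hsum_F_g, hsum_g_sq, ← mul_assoc, sq] at hspread
  rw [← sub_le_iff_le_add', ← hvariance, mul_comm]
  obtain hzero | hpos := (sum_nonneg fun P _ => sq_nonneg (f P)).eq_or_lt
  · rw [← hzero]
    exact mul_nonneg (card_sub_sq_div_card_nonneg F) (sub_nonneg.2 hlam)
  · exact le_of_mul_le_mul_right hspread hpos

end IsTwoDesign

end TwoDesign

section PointDesign

open scoped Classical

variable {K V : Type*} [Field K] [AddCommGroup V] [Module K V] [FiniteDimensional K V] {q k m : ℕ}

theorem finrank_sup_eq_two {P R : Grass K V 1} (h : P ≠ R) :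
    finrank K (P.1 ⊔ R.1 : Submodule K V) = 2 := by
  have hdisj : P.1 ⊓ R.1 = ⊥ := disjoint_iff.1 <|
    (Submodule.isAtom_iff_finrank_eq_one.2 P.2).disjoint_of_ne
      (Submodule.isAtom_iff_finrank_eq_one.2 R.2) (Subtype.coe_injective.ne h)
  have hadd := Submodule.finrank_sup_add_finrank_inf_eq P.1 R.1
  rwa [hdisj, finrank_bot, add_zero, P.2, R.2] at hadd

variable [Finite K]

theorem isTwoDesign_grass (hq : Nat.card K = q) (hn : finrank K V = k + m + 1) :
    IsTwoDesign (fun (P : Grass K V 1) (A : Grass K V (k + 1)) => P.1 ≤ A.1) (qInt q (k + 1))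
      (gaussBinom q (k + m) k) (gaussBinom q (k + m) k * qInt q k / qInt q (k + m)) where
  card_points A := by
    rw [card_grass_le, A.2, hq, gaussBinom_one_right (hq ▸ Finite.one_lt_card)]
  card_blocks P := by
    rw [card_grass_ge P.1 (by rw [P.2]), P.2, hn, hq, Nat.add_sub_cancel]
  card_common_blocks P R hPR := by
    have hdim := finrank_sup_eq_two hPR
    simp only [← sup_le_iff]
    cases k with
    | zero =>
      have hnot (A : Grass K V (0 + 1)) : ¬ P.1 ⊔ R.1 ≤ A.1 := fun hA => by
        have := Submodule.finrank_mono hA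
        have := A.2
        omega
      simp [hnot]
    | succ j =>
      have hpos : qInt q (j + m + 1) ≠ 0 := (qInt_pos q.cast_nonneg (Nat.succ_ne_zero _)).ne'
      rw [card_grass_ge (k := j) _ (by rw [hdim]), hdim, hq, hn, Nat.add_right_comm j 1 m,
        gaussBinom_succ_succ_mul (hq ▸ Finite.one_lt_card), mul_div_cancel_left₀ _ hpos]
      rfl

theorem sum_qInt_finrank_inf_le (hq : Nat.card K = q) (hn : finrank K V = k + m + 1)
    (hkm : k + m ≠ 0) (F : Finset (Grass K V (k + 1))) :
    ∑ A ∈ F, ∑ B ∈ F, qInt q (finrank K (A.1 ⊓ B.1 : Submodule K V)) ≤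
      (qInt q (k + 1) * #F) ^ 2 / qInt q (k + m + 1) +
        gaussBinom q (k + m) k * (q ^ k * qInt q m) / qInt q (k + m) *
          (#F - (#F : ℝ) ^ 2 / gaussBinom q (k + m + 1) (k + 1)) := by
  have hq1 : 1 < q := hq ▸ Finite.one_lt_card
  have hpos {i : ℕ} (hi : i ≠ 0) : 0 < qInt (q : ℝ) i := qInt_pos q.cast_nonneg hi
  have hr := gaussBinom_nonneg hq1 (k + m) k
  have hcard (A B : Submodule K V) :
      (#{P : Grass K V 1 | P.1 ≤ A ∧ P.1 ≤ B} : ℝ) =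
        qInt q (finrank K (A ⊓ B : Submodule K V)) := by
    simp only [← le_inf_iff, card_grass_le, hq, gaussBinom_one_right hq1]
  have hpoints : (Fintype.card (Grass K V 1) : ℝ) = qInt q (k + m + 1) := by
    rw [← Nat.card_eq_fintype_card, card_grass_one, hq, hn]
  have hblocks : (Fintype.card (Grass K V (k + 1)) : ℝ) = gaussBinom q (k + m + 1) (k + 1) := by
    rw [← Nat.card_eq_fintype_card, card_grass, hq, hn]
  have hnonempty : Nonempty (Grass K V 1) := Fintype.card_pos_iff.1 <| by
    exact_mod_cast hpoints ▸ hpos (Nat.succ_ne_zero _)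
  have horder : gaussBinom q (k + m) k - gaussBinom q (k + m) k * qInt q k / qInt q (k + m) =
      gaussBinom q (k + m) k * (q ^ k * qInt q m) / qInt q (k + m) := by
    have hkm' := (hpos hkm).ne'
    field_simp
    rw [qInt_add]
    ring
  have hle := (isTwoDesign_grass hq hn).sum_card_common_points_le (sub_nonneg.1 (horder ▸
    div_nonneg (mul_nonneg hr (mul_nonneg (by positivity) (qInt_nonneg q.cast_nonneg m)))
      (qInt_nonneg q.cast_nonneg _))) F
  simpa only [hcard, hpoints, hblocks, horder] using hle

theorem totalInt_le_of_pointDesign (hq : Nat.card K = q) (hn : finrank K V = k + m + 1)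
    (hkm : k + m ≠ 0) (F : Finset (Grass K V (k + 1))) :
    (totalInt F : ℝ) ≤ (k + 1) * (#F : ℝ) ^ 2 -
      qInt q (k + 1) * qInt q m / (qInt q (k + m + 1) * qInt q (k + m)) *
        (qInt q (k + m + 1) * (#F : ℝ) ^ 2 - gaussBinom q (k + m + 1) (k + 1) * #F) := by
  have hq1 : 1 < q := hq ▸ Finite.one_lt_card
  have hpos {i : ℕ} (hi : i ≠ 0) : 0 < qInt (q : ℝ) i := qInt_pos q.cast_nonneg hi
  have hconcave (A B : Grass K V (k + 1)) :
      qInt q (k + 1) - qInt q (finrank K (A.1 ⊓ B.1 : Submodule K V)) ≤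
        ((k + 1) - finrank K (A.1 ⊓ B.1 : Submodule K V)) * (q : ℝ) ^ k :=
    qInt_sub_le (by exact_mod_cast hq1.le) ((Submodule.finrank_mono inf_le_left).trans_eq A.2)
  have hsum := sum_le_sum fun A (_ : A ∈ F) => sum_le_sum fun B (_ : B ∈ F) => hconcave A B
  simp only [← sum_mul, sum_sub_distrib, sum_const, nsmul_eq_mul] at hsum
  have hidentity : qInt q (k + 1) * (#F : ℝ) ^ 2 -
      ((qInt q (k + 1) * #F) ^ 2 / qInt q (k + m + 1) +
        gaussBinom q (k + m) k * (q ^ k * qInt q m) / qInt q (k + m) *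
          (#F - (#F : ℝ) ^ 2 / gaussBinom q (k + m + 1) (k + 1))) =
      qInt q (k + 1) * qInt q m / (qInt q (k + m + 1) * qInt q (k + m)) *
        (qInt q (k + m + 1) * (#F : ℝ) ^ 2 - gaussBinom q (k + m + 1) (k + 1) * #F) * q ^ k := by
    have hn0 : qInt (q : ℝ) (k + m + 1) ≠ 0 := (hpos (Nat.succ_ne_zero _)).ne'
    have hkm0 := (hpos hkm).ne'
    have hb0 := (gaussBinom_pos hq1 (Nat.succ_le_succ (Nat.le_add_right k m))).ne'
    have hr : gaussBinom q (k + m) k =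
        gaussBinom q (k + m + 1) (k + 1) * qInt q (k + 1) / qInt q (k + m + 1) := by
      rw [gaussBinom_succ_succ_mul hq1, mul_div_cancel_left₀ _ hn0]
    rw [hr]
    field_simp
    rw [qInt_succ, qInt_succ, qInt_add]
    ring
  refine le_of_mul_le_mul_right ?_ (pow_pos (by exact_mod_cast hq1.pos : (0 : ℝ) < q) k)
  rw [sub_mul, ← hidentity, totalInt]
  push_cast
  linear_combination hsum + sum_qInt_finrank_inf_le hq hn hkm F

end PointDesign

section RelCodim

variable {K V : Type*} [Field K] [AddCommGroup V] [Module K V] {k : ℕ}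

/-- The codimension of `A ⊓ B` in `A`. It is not symmetric in general; on subspaces of equal
dimension it is the distance in the Grassmann graph. -/
noncomputable def relCodim (A B : Submodule K V) : ℕ :=
  finrank K A - finrank K (A ⊓ B : Submodule K V)

theorem relCodim_le (A B : Submodule K V) : relCodim A B ≤ finrank K A := Nat.sub_le _ _

variable [FiniteDimensional K V]

theorem relCodim_add_finrank_inf (A B : Submodule K V) :
    relCodim A B + finrank K (A ⊓ B : Submodule K V) = finrank K A :=
  Nat.sub_add_cancel (Submodule.finrank_mono inf_le_left)

theorem relCodim_eq_zero_iff (A B : Grass K V k) : relCodim A.1 B.1 = 0 ↔ A = B := by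
  refine ⟨fun h => Subtype.ext ?_, ?_⟩
  · have hadd := relCodim_add_finrank_inf A.1 B.1
    have hle : A.1 ≤ B.1 :=
      inf_eq_left.1 (Submodule.eq_of_le_of_finrank_eq inf_le_left (by omega))
    exact Submodule.eq_of_le_of_finrank_eq hle (A.2.trans B.2.symm)
  · rintro rfl
    rw [relCodim, inf_idem, Nat.sub_self]

theorem finrank_sup_eq_add_relCodim (A B : Submodule K V) :
    finrank K (A ⊔ B : Submodule K V) = finrank K B + relCodim A B := by
  have := Submodule.finrank_sup_add_finrank_inf_eq A B
  have := relCodim_add_finrank_inf A B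
  omega

open scoped Classical in
/-- By modularity `(U ⊔ B) ⊓ A = U ⊔ (B ⊓ A)`, which has dimension `k + 1` or `k`. -/
theorem relCodim_of_ge {U : Grass K V k} {A : Grass K V (k + 1)} (hUA : U.1 ≤ A.1)
    (B : Submodule K V) :
    relCodim A.1 B = if A.1 ≤ U.1 ⊔ B then relCodim U.1 B else relCodim U.1 B + 1 := by
  have hUA' : U.1 ⊓ (B ⊓ A.1) = U.1 ⊓ B := by
    rw [← inf_assoc, inf_eq_left.2 (inf_le_left.trans hUA)]
  have hdim := Submodule.finrank_sup_add_finrank_inf_eq U.1 (B ⊓ A.1)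
  rw [← sup_inf_assoc_of_le B hUA, hUA', inf_comm B] at hdim
  have hA := relCodim_add_finrank_inf A.1 B
  have hU := relCodim_add_finrank_inf U.1 B
  have hA2 := A.2
  have hU2 := U.2
  split_ifs with h
  · rw [inf_eq_right.2 h] at hdim
    omega
  · have hle : finrank K U.1 ≤ finrank K ((U.1 ⊔ B) ⊓ A.1 : Submodule K V) :=
      Submodule.finrank_mono (le_inf le_sup_left hUA)
    have hlt : finrank K ((U.1 ⊔ B) ⊓ A.1 : Submodule K V) < finrank K A.1 :=
      Submodule.finrank_lt_finrank_of_lt (inf_lt_right.2 h)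
    omega

open scoped Classical in
theorem relCodim_of_le {U : Grass K V k} {C : Grass K V (k + 1)} (hUC : U.1 ≤ C.1)
    (A : Submodule K V) :
    relCodim U.1 A = if C.1 ⊓ A ≤ U.1 then relCodim C.1 A - 1 else relCodim C.1 A := by
  have hUA : U.1 ⊓ (C.1 ⊓ A) = U.1 ⊓ A := by rw [← inf_assoc, inf_eq_left.2 hUC]
  have hC := relCodim_add_finrank_inf C.1 A
  have hU := relCodim_add_finrank_inf U.1 A
  have hC2 := C.2
  have hU2 := U.2
  split_ifs with h
  · rw [← hUA, inf_eq_right.2 h] at hU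
    omega
  · have hdim := Submodule.finrank_sup_add_finrank_inf_eq U.1 (C.1 ⊓ A)
    rw [hUA] at hdim
    have hlt : finrank K U.1 < finrank K (U.1 ⊔ C.1 ⊓ A : Submodule K V) :=
      Submodule.finrank_lt_finrank_of_lt (left_lt_sup.2 h)
    have hle : finrank K (U.1 ⊔ C.1 ⊓ A : Submodule K V) ≤ finrank K C.1 :=
      Submodule.finrank_mono (sup_le hUC inf_le_left)
    omega

end RelCodim

section Harmonic

open scoped Classical

theorem sum_ite_const_eq {ι : Type*} (s : Finset ι) (p : ι → Prop) (a b : ℝ) :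
    ∑ i ∈ s, (if p i then a else b) = #{i ∈ s | p i} * a + (#s - #{i ∈ s | p i}) * b := by
  have hcard := congrArg (Nat.cast (R := ℝ)) (card_filter_add_card_filter_not (s := s) p)
  push_cast at hcard
  rw [sum_ite, sum_const, sum_const, nsmul_eq_mul, nsmul_eq_mul, ← hcard, add_sub_cancel_left]

variable {K V : Type*} [Field K] [Finite K] [AddCommGroup V] [Module K V] [FiniteDimensional K V]
  {q k m : ℕ}

theorem sum_apply_relCodim_of_ge (hq : Nat.card K = q) (hn : finrank K V = k + m + 1) (φ : ℕ → ℝ)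
    (U : Grass K V k) (B : Grass K V (k + 1)) :
    ∑ A : Grass K V (k + 1) with U.1 ≤ A.1, φ (relCodim A.1 B.1) =
      qInt q (relCodim U.1 B.1 + 1) * φ (relCodim U.1 B.1) +
        q ^ (relCodim U.1 B.1 + 1) * qInt q (m - relCodim U.1 B.1) * φ (relCodim U.1 B.1 + 1) := by
  have hq1 : 1 < q := hq ▸ Finite.one_lt_card
  set t := relCodim U.1 B.1
  have hsup : finrank K (U.1 ⊔ B.1 : Submodule K V) = k + 1 + t := by
    rw [finrank_sup_eq_add_relCodim, B.2]
  have hsup_le := Submodule.finrank_le (U.1 ⊔ B.1)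
  have hnear : (#{A : Grass K V (k + 1) | U.1 ≤ A.1 ∧ A.1 ≤ U.1 ⊔ B.1} : ℝ) = qInt q (t + 1) := by
    rw [card_grass_ge_and_le le_sup_left (k := 1) (by rw [U.2, add_comm]), hsup, U.2, hq,
      gaussBinom_one_right hq1]
    congr 1; omega
  have hall : (#{A : Grass K V (k + 1) | U.1 ≤ A.1} : ℝ) =
      qInt q (t + 1) + q ^ (t + 1) * qInt q (m - t) := by
    rw [card_grass_ge U.1 (k := 1) (by rw [U.2, add_comm]), U.2, hq, hn, gaussBinom_one_right hq1,
      ← qInt_add]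
    congr 1; omega
  have hφ (A : Grass K V (k + 1)) (hA : A ∈ univ.filter (U.1 ≤ ·.1)) :
      φ (relCodim A.1 B.1) = if A.1 ≤ U.1 ⊔ B.1 then φ t else φ (t + 1) := by
    rw [relCodim_of_ge (mem_filter.1 hA).2, apply_ite φ]
  rw [sum_congr rfl hφ, sum_ite_const_eq, filter_filter, hnear, hall, add_sub_cancel_left]

theorem sum_apply_relCodim_of_le (hq : Nat.card K = q) (φ : ℕ → ℝ) (C A : Grass K V (k + 1)) :
    ∑ U : Grass K V k with U.1 ≤ C.1, φ (relCodim U.1 A.1) =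
      qInt q (relCodim C.1 A.1) * φ (relCodim C.1 A.1 - 1) +
        q ^ relCodim C.1 A.1 * qInt q (k + 1 - relCodim C.1 A.1) * φ (relCodim C.1 A.1) := by
  have hq1 : 1 < q := hq ▸ Finite.one_lt_card
  set t := relCodim C.1 A.1 with ht
  have hadd := relCodim_add_finrank_inf C.1 A.1
  rw [C.2, ← ht] at hadd
  have hnear : (#{U : Grass K V k | U.1 ≤ C.1 ∧ C.1 ⊓ A.1 ≤ U.1} : ℝ) = qInt q t := by
    simp only [and_comm (b := _ ⊓ _ ≤ _)]
    obtain hzero | ⟨s, hs⟩ : t = 0 ∨ ∃ s, t = s + 1 := by cases t <;> simp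
    · have hnot (U : Grass K V k) : ¬ C.1 ⊓ A.1 ≤ U.1 := fun hU => by
        have := Submodule.finrank_mono hU
        have := U.2
        omega
      simp [hnot, hzero]
    · rw [card_grass_ge_and_le inf_le_left (k := s) (by omega), C.2, hq,
        show k + 1 - finrank K (C.1 ⊓ A.1 : Submodule K V) = s + 1 by omega,
        gaussBinom_succ_self hq1, hs]
  have hall : (#{U : Grass K V k | U.1 ≤ C.1} : ℝ) = qInt q t + q ^ t * qInt q (k + 1 - t) := by
    rw [card_grass_le, C.2, hq, gaussBinom_succ_self hq1, ← qInt_add]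
    congr 1; omega
  have hφ (U : Grass K V k) (hU : U ∈ univ.filter (·.1 ≤ C.1)) :
      φ (relCodim U.1 A.1) = if C.1 ⊓ A.1 ≤ U.1 then φ (t - 1) else φ t := by
    rw [relCodim_of_le (mem_filter.1 hU).2, apply_ite φ]
  rw [sum_congr rfl hφ, sum_ite_const_eq, filter_filter, hnear, hall, add_sub_cancel_left]

/-- The radial function `t ↦ w t` for which `A ↦ w (dim A - dim (A ⊓ B))` is harmonic on the
`(k + 1)`-dimensional subspaces of a `(k + m + 1)`-dimensional space: the solution of
`[t + 1] * w t + q ^ (t + 1) * [m - t] * w (t + 1) = 0` with `w 0 = 1`. -/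
noncomputable def kernelWeight (q : ℝ) (m t : ℕ) : ℝ :=
  ∏ s ∈ range t, -(qInt q (s + 1) / (q ^ (s + 1) * qInt q (m - s)))

/-- The ratio between the sum of a harmonic function over the sphere of radius `t` and its value at
the centre, in the graph of `(k + 1)`-dimensional subspaces: the solution of
`[t + 1] * c (t + 1) + q ^ t * [k + 1 - t] * c t = 0` with `c 0 = 1`. -/
noncomputable def sphereCoeff (q : ℝ) (k t : ℕ) : ℝ :=
  ∏ s ∈ range t, -(q ^ s * qInt q (k + 1 - s) / qInt q (s + 1))

theorem kernelWeight_succ {q : ℝ} (hq : 0 < q) {m t : ℕ} (ht : t < m) :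
    qInt q (t + 1) * kernelWeight q m t +
      q ^ (t + 1) * qInt q (m - t) * kernelWeight q m (t + 1) = 0 := by
  have hmt : qInt q (m - t) ≠ 0 := (qInt_pos hq.le (Nat.sub_ne_zero_of_lt ht)).ne'
  rw [kernelWeight, kernelWeight, prod_range_succ]
  field_simp
  ring

theorem sphereCoeff_succ {q : ℝ} (hq : 0 ≤ q) (k t : ℕ) :
    qInt q (t + 1) * sphereCoeff q k (t + 1) +
      q ^ t * qInt q (k + 1 - t) * sphereCoeff q k t = 0 := by
  have ht : qInt q (t + 1) ≠ 0 := (qInt_pos hq t.succ_ne_zero).ne'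
  rw [sphereCoeff, sphereCoeff, prod_range_succ]
  field_simp
  ring

theorem sum_kernelWeight_mul_sphereCoeff_pos {q : ℝ} (hq : 0 ≤ q) (m k l : ℕ) :
    0 < ∑ t ∈ range (l + 1), kernelWeight q m t * sphereCoeff q k t := by
  refine sum_pos' (fun t _ => ?_) ⟨0, mem_range.2 l.succ_pos, by simp [kernelWeight, sphereCoeff]⟩
  rw [kernelWeight, sphereCoeff, ← prod_mul_distrib]
  refine prod_nonneg fun s _ => ?_
  rw [neg_mul_neg]
  have hnonneg := qInt_nonneg hq
  exact mul_nonneg (div_nonneg (hnonneg _) (mul_nonneg (pow_nonneg hq _) (hnonneg _)))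
    (div_nonneg (mul_nonneg (pow_nonneg hq _) (hnonneg _)) (hnonneg _))

/-- A function on `(k + 1)`-dimensional subspaces is harmonic if its sum over the subspaces
containing any given `k`-dimensional one vanishes. Every radial operator on the Grassmannian acts on
these functions as a scalar. -/
def IsHarmonic (h : Grass K V (k + 1) → ℝ) : Prop :=
  ∀ U : Grass K V k, ∑ A : Grass K V (k + 1) with U.1 ≤ A.1, h A = 0

theorem isHarmonic_kernelWeight (hq : Nat.card K = q) (hn : finrank K V = k + m + 1) (hkm : k < m)
    (B : Grass K V (k + 1)) :
    IsHarmonic fun A : Grass K V (k + 1) => kernelWeight q m (relCodim A.1 B.1) := fun U => by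
  rw [sum_apply_relCodim_of_ge hq hn (kernelWeight q m)]
  exact kernelWeight_succ (by exact_mod_cast hq ▸ Nat.card_pos)
    (((relCodim_le _ _).trans_eq U.2).trans_lt hkm)

namespace IsHarmonic

theorem sum {ι : Type*} (s : Finset ι) {h : ι → Grass K V (k + 1) → ℝ}
    (hh : ∀ i ∈ s, IsHarmonic (h i)) : IsHarmonic fun A => ∑ i ∈ s, h i A := fun U => by
  rw [sum_comm]
  exact sum_eq_zero fun i hi => hh i hi U

variable {h : Grass K V (k + 1) → ℝ}

theorem sum_sphere_succ (hh : IsHarmonic h) (hq : Nat.card K = q) (A : Grass K V (k + 1)) (t : ℕ) :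
    qInt q (t + 1) * ∑ C with relCodim C.1 A.1 = t + 1, h C +
      q ^ t * qInt q (k + 1 - t) * ∑ C with relCodim C.1 A.1 = t, h C = 0 := by
  have hfactor (C : Grass K V (k + 1)) :
      ∑ U : Grass K V k with U.1 ≤ C.1, (if relCodim U.1 A.1 = t then 1 else 0 : ℝ) =
        (if relCodim C.1 A.1 = t + 1 then qInt q (t + 1) else 0) +
          if relCodim C.1 A.1 = t then q ^ t * qInt q (k + 1 - t) else 0 := by
    rw [sum_apply_relCodim_of_le hq (fun d => if d = t then 1 else 0)]
    cases relCodim C.1 A.1 <;> aesop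
  calc qInt q (t + 1) * ∑ C with relCodim C.1 A.1 = t + 1, h C +
        q ^ t * qInt q (k + 1 - t) * ∑ C with relCodim C.1 A.1 = t, h C
      = ∑ C, (∑ U : Grass K V k with U.1 ≤ C.1, if relCodim U.1 A.1 = t then 1 else 0) * h C := by
        simp only [hfactor, add_mul, sum_add_distrib, ite_mul, zero_mul, ← sum_filter, mul_sum]
    _ = ∑ U : Grass K V k, (if relCodim U.1 A.1 = t then 1 else 0) *
          ∑ C : Grass K V (k + 1) with U.1 ≤ C.1, h C := by
        simp only [sum_filter, sum_mul, mul_sum, ite_mul, mul_ite, zero_mul, mul_zero]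
        exact sum_comm
    _ = 0 := by simp only [hh _, mul_zero, sum_const_zero]

theorem sum_sphere (hh : IsHarmonic h) (hq : Nat.card K = q) (A : Grass K V (k + 1)) (t : ℕ) :
    ∑ C with relCodim C.1 A.1 = t, h C = sphereCoeff q k t * h A := by
  induction t with
  | zero => simp [relCodim_eq_zero_iff, filter_eq', sphereCoeff]
  | succ t ih =>
    have ht : qInt q (t + 1) ≠ 0 := (qInt_pos q.cast_nonneg t.succ_ne_zero).ne'
    have hsum := hh.sum_sphere_succ hq A t
    have hcoeff := sphereCoeff_succ q.cast_nonneg k t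
    rw [ih] at hsum
    refine mul_left_cancel₀ ht ?_
    linear_combination hsum - h A * hcoeff

theorem sum_radial_mul (hh : IsHarmonic h) (hq : Nat.card K = q) (φ : ℕ → ℝ)
    (A : Grass K V (k + 1)) :
    ∑ C : Grass K V (k + 1), φ (relCodim C.1 A.1) * h C =
      (∑ t ∈ range (k + 2), φ t * sphereCoeff q k t) * h A := by
  have hmaps : ∀ C ∈ (univ : Finset (Grass K V (k + 1))), relCodim C.1 A.1 ∈ range (k + 2) :=
    fun C _ => mem_range.2 (Nat.lt_succ_of_le ((relCodim_le _ _).trans_eq C.2))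
  rw [← sum_fiberwise_of_maps_to hmaps, sum_mul]
  refine sum_congr rfl fun t _ => ?_
  rw [mul_assoc, ← hh.sum_sphere hq A t, mul_sum]
  exact sum_congr rfl fun C hC => by rw [(mem_filter.1 hC).2]

end IsHarmonic

/-- The matrix with entries `kernelWeight q m (relCodim A B)` has harmonic columns, which makes it a
positive multiple of its own square. -/
theorem sum_kernelWeight_relCodim_nonneg (hq : Nat.card K = q) (hn : finrank K V = k + m + 1)
    (hkm : k < m) (F : Finset (Grass K V (k + 1))) :
    0 ≤ ∑ A ∈ F, ∑ B ∈ F, kernelWeight q m (relCodim A.1 B.1) := by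
  set h : Grass K V (k + 1) → ℝ := fun A => ∑ B ∈ F, kernelWeight q m (relCodim A.1 B.1) with hh
  have hharm : IsHarmonic h := IsHarmonic.sum F fun B _ => isHarmonic_kernelWeight hq hn hkm B
  have hκ := sum_kernelWeight_mul_sphereCoeff_pos (q.cast_nonneg (α := ℝ)) m k (k + 1)
  refine nonneg_of_mul_nonneg_right ?_ hκ
  calc 0 ≤ ∑ C, h C * h C := sum_nonneg fun C _ => mul_self_nonneg (h C)
    _ = ∑ A ∈ F, ∑ C, kernelWeight q m (relCodim C.1 A.1) * h C := by
        rw [sum_comm]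
        simp only [← sum_mul, hh]
    _ = (∑ t ∈ range (k + 2), kernelWeight q m t * sphereCoeff q k t) * ∑ A ∈ F, h A := by
        simp only [hharm.sum_radial_mul hq (kernelWeight q m), mul_sum]

end Harmonic

section SecondBound

section Real

variable {q : ℝ}

theorem abs_kernelWeight_le (hq : 2 ≤ q) {m t : ℕ} (ht : t + 1 ≤ m) :
    q * qInt q m * |kernelWeight q m (t + 1)| ≤ 1 := by
  have hq0 : 0 < q := by linarith
  have hpos {i : ℕ} (hi : i ≠ 0) : 0 < qInt q i := qInt_pos hq0.le hi
  rw [kernelWeight, prod_range_succ', abs_mul, abs_neg, zero_add, qInt_one, pow_one, Nat.sub_zero,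
    abs_of_pos (one_div_pos.2 (mul_pos hq0 (hpos (by omega)))), mul_left_comm, mul_one_div_cancel
    (mul_pos hq0 (hpos (by omega))).ne', mul_one, abs_prod]
  refine prod_le_one (fun _ _ => abs_nonneg _) fun s hs => ?_
  have hs' : m - (s + 1) ≠ 0 := by have := mem_range.1 hs; omega
  have hnum : qInt q (s + 1 + 1) ≤ q ^ (s + 1 + 1) := by
    linarith [qInt_le_pow_sub_one hq (s + 1 + 1)]
  rw [abs_neg, abs_of_nonneg (div_nonneg (hpos (Nat.succ_ne_zero _)).le
    (mul_nonneg (pow_nonneg hq0.le _) (hpos hs').le))]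
  exact div_le_one_of_le₀ (hnum.trans (le_mul_of_one_le_right (by positivity)
    (one_le_qInt hq0.le hs'))) (mul_nonneg (by positivity) (hpos hs').le)

theorem qInt_mul_add_inv_le (hq : 2 ≤ q) (j p : ℕ) :
    qInt q j * (q * qInt q p + 1 + 1 / q) ≤ qInt q (j + p + 1) := by
  have hinv : 1 / q ≤ 1 := div_le_one_of_le₀ (by linarith) (by linarith)
  have hj := qInt_nonneg (by linarith : 0 ≤ q) j
  have hp := qInt_nonneg (by linarith : 0 ≤ q) (p + 1)
  calc qInt q j * (q * qInt q p + 1 + 1 / q) ≤ qInt q j * q ^ (p + 1) := by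
        refine mul_le_mul_of_nonneg_left ?_ hj
        rw [← qInt_succ]
        linarith [qInt_le_pow_sub_one hq (p + 1)]
    _ ≤ qInt q (j + p + 1) := by
        rw [add_assoc, add_comm j, qInt_add]
        linarith

theorem qInt_add_mul_qInt (q : ℝ) (j p : ℕ) :
    qInt q (j + p + 1) + q * qInt q j * qInt q p = qInt q (j + 1) * qInt q (p + 1) := by
  have hp : qInt q p + q ^ p = q * qInt q p + 1 := by
    rw [← qInt_succ, qInt_add, qInt_one, mul_one]
  rw [add_assoc, add_comm j, qInt_add, qInt_succ q j]
  rw [qInt_succ q p]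
  linear_combination q * qInt q j * hp

/-- The coefficients make this an equality for `t = 1`, where the kernel is `-1 / (q * [p + 1])`. -/
theorem add_mul_kernelWeight_le (hq : 2 ≤ q) (j : ℕ) {p t : ℕ} (ht0 : t ≠ 0) (ht : t ≤ p + 1) :
    qInt q (j + 1) * qInt q (p + 1) +
        q * qInt q j * qInt q p * (q * qInt q (p + 1) * kernelWeight q (p + 1) t) ≤
      qInt q (j + p + 1) * t := by
  have hq0 : 0 < q := by linarith
  have hp1 : 0 < qInt q (p + 1) := qInt_pos hq0.le p.succ_ne_zero
  have hj := qInt_nonneg hq0.le j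
  have hcoeff : 0 ≤ q * qInt q j * qInt q p :=
    mul_nonneg (mul_nonneg hq0.le hj) (qInt_nonneg hq0.le p)
  have hbound := qInt_mul_add_inv_le hq j p
  rw [← qInt_add_mul_qInt]
  obtain rfl | rfl | ht3 : t = 1 ∨ t = 2 ∨ 3 ≤ t := by omega
  · have hone : q * qInt q (p + 1) * kernelWeight q (p + 1) 1 = -1 := by
      simp only [kernelWeight, prod_range_one, zero_add, qInt_one, pow_one, Nat.sub_zero]
      field_simp
    rw [hone, Nat.cast_one]
    linarith
  · have hp : qInt q p ≠ 0 := (qInt_pos hq0.le (by omega)).ne'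
    have htwo : q * qInt q j * qInt q p * (q * qInt q (p + 1) * kernelWeight q (p + 1) 2) =
        qInt q j * (1 + 1 / q) := by
      simp only [kernelWeight, prod_range_succ, prod_range_zero, zero_add, qInt_one, pow_one,
        Nat.sub_zero, Nat.add_sub_cancel, one_mul, qInt_succ q 1]
      field_simp
      ring
    rw [htwo, Nat.cast_two]
    linarith
  · have habs : q * qInt q (p + 1) * kernelWeight q (p + 1) t ≤ 1 := by
      obtain ⟨s, rfl⟩ := Nat.exists_eq_succ_of_ne_zero ht0
      exact (mul_le_mul_of_nonneg_left (le_abs_self _)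
        (mul_nonneg hq0.le hp1.le)).trans (abs_kernelWeight_le hq ht)
    have hcoeff_le : q * qInt q j * qInt q p ≤ qInt q (j + p + 1) := by
      linarith [mul_nonneg hj (add_nonneg zero_le_one (one_div_pos.2 hq0).le)]
    calc _ ≤ qInt q (j + p + 1) + q * qInt q j * qInt q p + q * qInt q j * qInt q p * 1 := by gcongr
      _ ≤ qInt q (j + p + 1) * 3 := by linarith
      _ ≤ qInt q (j + p + 1) * t :=
          mul_le_mul_of_nonneg_left (by exact_mod_cast ht3) (qInt_nonneg hq0.le _)

end Real

variable {K V : Type*} [Field K] [AddCommGroup V] [Module K V] [FiniteDimensional K V] {q j k p : ℕ}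

theorem totalInt_add_sum_relCodim (F : Finset (Grass K V k)) :
    totalInt F + ∑ A ∈ F, ∑ B ∈ F, relCodim A.1 B.1 = k * #F ^ 2 := by
  have hadd (A B : Grass K V k) :
      finrank K (A.1 ⊓ B.1 : Submodule K V) + relCodim A.1 B.1 = k := by
    rw [add_comm, relCodim_add_finrank_inf, A.2]
  simp only [totalInt, ← sum_add_distrib, hadd, sum_const, smul_eq_mul]
  ring

theorem totalInt_le_mul_sq (F : Finset (Grass K V k)) : totalInt F ≤ k * #F ^ 2 :=
  (Nat.le_add_right _ _).trans_eq (totalInt_add_sum_relCodim F)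

variable [Finite K]

open scoped Classical in
theorem le_sum_relCodim (hq : Nat.card K = q) (hn : finrank K V = j + p + 3) (hjp : j < p)
    (F : Finset (Grass K V (j + 2))) :
    qInt q (p + 1) *
        (qInt q (j + 1) * (#F : ℝ) ^ 2 - (1 + q * qInt q j * qInt q (p + 1)) * #F) ≤
      qInt q (j + p + 1) * ∑ A ∈ F, ∑ B ∈ F, (relCodim A.1 B.1 : ℝ) := by
  have hq2 : (2 : ℝ) ≤ q := by exact_mod_cast hq ▸ Finite.one_lt_card
  have hnonneg := qInt_nonneg (q.cast_nonneg (α := ℝ))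
  set c : ℝ := q * qInt q j * qInt q p * (q * qInt q (p + 1)) with hc
  have hpointwise (A B : Grass K V (j + 2)) :
      qInt q (j + 1) * qInt q (p + 1) + c * kernelWeight q (p + 1) (relCodim A.1 B.1) -
          (if A = B then qInt q (p + 1) * (1 + q * qInt q j * qInt q (p + 1)) else 0) ≤
        qInt q (j + p + 1) * relCodim A.1 B.1 := by
    split_ifs with hAB
    · rw [(relCodim_eq_zero_iff A B).2 hAB, kernelWeight, prod_range_zero, Nat.cast_zero, hc,
        qInt_succ q j, qInt_succ q p]
      exact le_of_eq (by ring)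
    · have hle := add_mul_kernelWeight_le hq2 j (mt (relCodim_eq_zero_iff A B).1 hAB)
        (show relCodim A.1 B.1 ≤ p + 1 from (relCodim_le _ _).trans (by rw [A.2]; omega))
      rwa [sub_zero, hc, mul_assoc (q * qInt q j * qInt q p : ℝ)]
  have hkernel : 0 ≤ c * ∑ A ∈ F, ∑ B ∈ F, kernelWeight q (p + 1) (relCodim A.1 B.1) :=
    mul_nonneg (mul_nonneg (mul_nonneg (mul_nonneg q.cast_nonneg (hnonneg _)) (hnonneg _))
      (mul_nonneg q.cast_nonneg (hnonneg _)))
      (sum_kernelWeight_relCodim_nonneg (k := j + 1) hq (by omega) (by omega) F)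
  have hsum := sum_le_sum fun A (_ : A ∈ F) => sum_le_sum fun B (_ : B ∈ F) => hpointwise A B
  simp only [sum_sub_distrib, sum_add_distrib, ← mul_sum, sum_const, sum_ite_eq, nsmul_eq_mul]
    at hsum
  rw [sum_ite_mem, inter_self, sum_const, nsmul_eq_mul] at hsum
  linear_combination hsum + hkernel

theorem totalInt_le_of_harmonicKernel (hq : Nat.card K = q) (hn : finrank K V = j + p + 3)
    (hjp : j < p) (F : Finset (Grass K V (j + 2))) :
    (totalInt F : ℝ) ≤ (j + 2) * (#F : ℝ) ^ 2 - qInt q (p + 1) / qInt q (j + p + 1) *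
      (qInt q (j + 1) * (#F : ℝ) ^ 2 - gaussBinom q (j + p + 1) j * #F) := by
  have hq1 : 1 < q := hq ▸ Finite.one_lt_card
  have hpos : 0 < qInt (q : ℝ) (j + p + 1) := qInt_pos q.cast_nonneg (Nat.succ_ne_zero _)
  have htotal := congrArg (Nat.cast (R := ℝ)) (totalInt_add_sum_relCodim F)
  push_cast at htotal
  have hcount := mul_le_mul_of_nonneg_left (one_add_mul_qInt_le_gaussBinom hq1 j (p + 1))
    (mul_nonneg (qInt_nonneg (q.cast_nonneg (α := ℝ)) (p + 1)) (#F).cast_nonneg)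
  rw [← add_assoc] at hcount
  rw [div_mul_eq_mul_div, le_sub_comm, div_le_iff₀' hpos]
  linear_combination le_sum_relCodim hq hn hjp F + hcount + qInt (q : ℝ) (j + p + 1) * htotal

end SecondBound

section Bounds

variable {K V : Type*} [Field K] [Finite K] [AddCommGroup V] [Module K V] [FiniteDimensional K V]
  {q n k M : ℕ}

theorem totalInt_le (hq : Nat.card K = q) (hn : finrank K V = n) (hk : 1 ≤ k) (hkn : k ≤ n)
    (hM : 1 ≤ M) (F : Finset (Grass K V k)) (hF : #F = M) :
    (totalInt F : ℝ) ≤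
      (gaussBinom q n k / M - gaussBinom q n 1) *
        (q * (M : ℝ) ^ 2 * gaussBinom q k 1 * gaussBinom q (n - k) 1 /
          (gaussBinom q n 1 * (gaussBinom q n 1 - 1))) + k * (M : ℝ) ^ 2 := by
  have hq1 : 1 < q := hq ▸ Finite.one_lt_card
  obtain ⟨k, rfl⟩ := Nat.exists_eq_add_of_le' hk
  obtain ⟨m, rfl⟩ := Nat.exists_eq_add_of_le hkn
  obtain hkm | hkm := eq_or_ne (k + m) 0
  · obtain ⟨rfl, rfl⟩ := Nat.add_eq_zero_iff.1 hkm
    have hle : (totalInt F : ℝ) ≤ 1 * (M : ℝ) ^ 2 := by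
      exact_mod_cast hF ▸ totalInt_le_mul_sq F
    simpa [gaussBinom_one_right hq1] using hle
  rw [Nat.add_right_comm] at hn ⊢
  have hsub : k + m + 1 - (k + 1) = m := by omega
  have hM0 : (M : ℝ) ≠ 0 := Nat.cast_ne_zero.2 (Nat.one_le_iff_ne_zero.1 hM)
  have hq0 : (q : ℝ) ≠ 0 := by exact_mod_cast hq1.ne_bot
  have hn0 : qInt (q : ℝ) (k + m + 1) ≠ 0 := (qInt_pos q.cast_nonneg (Nat.succ_ne_zero _)).ne'
  have hkm0 : qInt (q : ℝ) (k + m) ≠ 0 := (qInt_pos q.cast_nonneg hkm).ne'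
  have hpred : qInt (q : ℝ) (k + m + 1) - 1 = q * qInt q (k + m) := by
    rw [qInt_succ, add_sub_cancel_right]
  refine (totalInt_le_of_pointDesign hq hn hkm F).trans_eq ?_
  simp only [hF, hsub, gaussBinom_one_right hq1, hpred]
  push_cast
  field_simp
  ring

theorem totalInt_le_of_two_mul_le (hq : Nat.card K = q) (hn : finrank K V = n) (hk : 1 ≤ k)
    (hkn : 2 * k ≤ n) (hM : 1 ≤ M) (F : Finset (Grass K V k)) (hF : #F = M) :
    (totalInt F : ℝ) ≤
      (gaussBinom q n k / M -
          ((q : ℝ) ^ n - 1) * ((q : ℝ) ^ (n - 1) - 1) / (((q : ℝ) - 1) * ((q : ℝ) ^ k - 1))) *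
        ((M : ℝ) ^ 2 * ((q : ℝ) ^ k - 1) * ((q : ℝ) ^ (k - 1) - 1) * ((q : ℝ) ^ (n - k) - 1) /
          (((q : ℝ) ^ n - 1) * ((q : ℝ) ^ (n - 1) - 1) * ((q : ℝ) ^ (n - 2) - 1))) +
        k * (M : ℝ) ^ 2 := by
  have hq1 : 1 < q := hq ▸ Finite.one_lt_card
  obtain rfl | ⟨j, rfl⟩ : k = 1 ∨ ∃ j, k = j + 2 := by
    obtain _ | _ | j := k <;> simp at hk ⊢
  · have hle : (totalInt F : ℝ) ≤ 1 * (M : ℝ) ^ 2 := by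
      exact_mod_cast hF ▸ totalInt_le_mul_sq F
    simpa using hle
  obtain ⟨p, rfl⟩ : ∃ p, n = j + p + 3 := ⟨n - (j + 3), by omega⟩
  have hpred : j + p + 3 - 1 = j + p + 2 := rfl
  have hpred2 : j + p + 3 - 2 = j + p + 1 := rfl
  have hsub : j + p + 3 - (j + 2) = p + 1 := by omega
  have hM0 : (M : ℝ) ≠ 0 := Nat.cast_ne_zero.2 (Nat.one_le_iff_ne_zero.1 hM)
  have hq0 : (q : ℝ) - 1 ≠ 0 := (sub_pos.2 (by exact_mod_cast hq1)).ne'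
  have hpos (i : ℕ) : qInt (q : ℝ) (i + 1) ≠ 0 := (qInt_pos q.cast_nonneg i.succ_ne_zero).ne'
  have hk1 := hpos (j + 1)
  have hn0 := hpos (j + p)
  have hn1 := hpos (j + p + 1)
  have hn2 := hpos (j + p + 2)
  have hbinom : gaussBinom q (j + p + 1) j = gaussBinom q (j + p + 3) (j + 2) *
      qInt q (j + 2) * qInt q (j + 1) / (qInt q (j + p + 3) * qInt q (j + p + 2)) := by
    rw [gaussBinom_succ_succ_mul hq1, mul_assoc, gaussBinom_succ_succ_mul hq1]
    field_simp
  refine (totalInt_le_of_harmonicKernel hq hn (by omega) F).trans_eq ?_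
  simp only [hF, hpred, hpred2, hsub, hbinom, ← qInt_mul_sub_one, Nat.add_succ_sub_one]
  push_cast
  field_simp
  ring

end Bounds

theorem mainTheorem3_general {K V : Type*} [Field K] [Finite K] [AddCommGroup V] [Module K V]
    [FiniteDimensional K V] (q n k M : ℕ) (hq : Nat.card K = q) (hn : Module.finrank K V = n)
    (hk : 1 ≤ k) (hkn : k ≤ n) (hM : 1 ≤ M)
    (F : Finset (Grass K V k)) (hF : F.card = M) :
    (maxTotalInt F : ℝ) ≤
        (gaussBinom q n k / M - gaussBinom q n 1) *
          (q * (M : ℝ) ^ 2 * gaussBinom q k 1 * gaussBinom q (n - k) 1 /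
            (gaussBinom q n 1 * (gaussBinom q n 1 - 1))) + k * (M : ℝ) ^ 2 ∧
    (2 * k ≤ n →
      (maxTotalInt F : ℝ) ≤
        (gaussBinom q n k / M -
            ((q : ℝ) ^ n - 1) * ((q : ℝ) ^ (n - 1) - 1) / (((q : ℝ) - 1) * ((q : ℝ) ^ k - 1))) *
          ((M : ℝ) ^ 2 * ((q : ℝ) ^ k - 1) * ((q : ℝ) ^ (k - 1) - 1) * ((q : ℝ) ^ (n - k) - 1) /
            (((q : ℝ) ^ n - 1) * ((q : ℝ) ^ (n - 1) - 1) * ((q : ℝ) ^ (n - 2) - 1))) +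
          k * (M : ℝ) ^ 2) := by
  obtain ⟨G, hG, hmax⟩ := (isGreatest_maxTotalInt F).1
  rw [← hmax]
  exact ⟨totalInt_le hq hn hk hkn hM G (hG.trans hF),
    fun h2k => totalInt_le_of_two_mul_le hq hn hk h2k hM G (hG.trans hF)⟩

theorem mainTheorem3 {K V : Type*} [Field K] [Finite K] [AddCommGroup V] [Module K V]
    [FiniteDimensional K V] (q n k M : ℕ) (hq : Nat.card K = q) (hn : Module.finrank K V = n)
    (hk : 1 ≤ k) (hkn : k ≤ n) (hM : 1 ≤ M)
    (F : Finset (Grass K V k)) (hF : F.card = M) :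
    (maxTotalInt F : ℝ) ≤
        (gaussBinom q n k / M - gaussBinom q n 1) *
          (q * (M : ℝ) ^ 2 * gaussBinom q k 1 * gaussBinom q (n - k) 1 /
            (gaussBinom q n 1 * (gaussBinom q n 1 - 1))) + k * (M : ℝ) ^ 2 ∧
    (2 * k ≤ n → (M : ℝ) ≤ gaussBinom q (n - 1) (k - 1) →
      (maxTotalInt F : ℝ) ≤
        (gaussBinom q n k / M -
            ((q : ℝ) ^ n - 1) * ((q : ℝ) ^ (n - 1) - 1) / (((q : ℝ) - 1) * ((q : ℝ) ^ k - 1))) *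
          ((M : ℝ) ^ 2 * ((q : ℝ) ^ k - 1) * ((q : ℝ) ^ (k - 1) - 1) * ((q : ℝ) ^ (n - k) - 1) /
            (((q : ℝ) ^ n - 1) * ((q : ℝ) ^ (n - 1) - 1) * ((q : ℝ) ^ (n - 2) - 1))) +
          k * (M : ℝ) ^ 2) := by
  have hbounds := mainTheorem3_general q n k M hq hn hk hkn hM F hF
  exact ⟨hbounds.1, fun h2k _ => hbounds.2 h2k⟩
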